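/- Write $(A;q)_n=\prod_{i=0}^{n-1}(1-Aq^i)$, $(A;q)_\infty=\prod_{i\ge 0}(1-Aq^i)$, $(A,B,C;q)_\infty=(A;q)_\infty(B;q)_\infty(C;q)_\infty$ and $(q)_n=(q;q)_n$. Let $k\ge 1$ and $j,r\ge 0$ be integers with $j+r\le k$, and let $q$ be a complex number with $0<|q|<1$. Then $$ \sum_{s_1\ge s_2\ge\cdots\ge s_k\ge 0} \frac{q^{-s_1-\cdots-s_j}(1+q^{s_1+s_2})(1+q^{s_2+s_3})\cdots(1+q^{s_{j-1}+s_j})} {(q)_{s_1-s_2}\cdots(q)_{s_{k-1}-s_k}\,(q^2;q^2)_{s_k}}\; q^{s_1^2+\cdots+s_k^2+s_{k-r+1}+\cdots+s_k} =\sum_{s=0}^{j}\binom{j}{s} \frac{(q^{k+1-r+j-2s},\,q^{k+1+r-j+2s},\,q^{2k+2};\,q^{2k+2})_\infty}{(q;q)_\infty}, $$ where the sum on the left runs over integers $s_1,\dots,s_k$ and converges absolutely. Moreover, put $b_1=q^{-s_1}$ and $b_i=q^{-s_i}(1+q^{s_{i-1}+s_i})$ for $2\le i\le k-r$. For every $j$-element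 subset $S\subseteq\{1,2,\dots,k-r\}$ the identity remains true, with the same right-hand side and with absolute convergence, if the factor $q^{-s_1-\cdots-s_j}(1+q^{s_1+s_2})\cdots(1+q^{s_{j-1}+s_j})$ (which is $b_1b_2\cdots b_j$) is replaced by $\prod_{i\in S}b_i$. -/

import Mathlib

open Finset

noncomputable section

/-- The finite `q`-shifted factorial `(A; q)_n = ∏_{i=0}^{n-1} (1 - A q^i)`. -/
def qPoch (A q : ℂ) (n : ℕ) : ℂ := ∏ i ∈ range n, (1 - A * q ^ i)

/-- The infinite `q`-shifted factorial `(A; q)_∞ = ∏_{i ≥ 0} (1 - A q^i)`, for `‖q‖ < 1`. -/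
def qPochInf (A q : ℂ) : ℂ := ∏' i : ℕ, (1 - A * q ^ i)

/-- For `‖q‖ < 1` the product that defines `(A; q)_∞` converges. -/
theorem multipliable_qPochInf (A q : ℂ) (hq : ‖q‖ < 1) :
    Multipliable fun i : ℕ => 1 - A * q ^ i := by
  have h : Summable fun i : ℕ => ‖-(A * q ^ i)‖ := by
    simp only [norm_neg, norm_mul, norm_pow]
    exact (summable_geometric_of_lt_one (norm_nonneg q) hq).mul_left ‖A‖
  simpa only [sub_eq_add_neg] using multipliable_one_add_of_summable h

/-- The index set of the `k`-fold sum: tuples `s_1 ≥ s_2 ≥ ⋯ ≥ s_k ≥ 0` of integers. -/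
abbrev DecTuple (k : ℕ) : Type := {s : Fin k → ℕ // Antitone s}

/-- The entry `s_i` of a tuple, numbered from `1` to `k` (and `0` outside this range). -/
def DecTuple.entry {k : ℕ} (s : DecTuple k) (i : ℕ) : ℕ :=
  if h : 1 ≤ i ∧ i ≤ k then s.1 ⟨i - 1, by omega⟩ else 0

/-- The `i`-th available factor: `q^{-s_1}` for `i = 1`,
and `q^{-s_i} (1 + q^{s_{i-1} + s_i})` for `i ≥ 2`. -/
def binFactor {k : ℕ} (q : ℂ) (s : DecTuple k) (i : ℕ) : ℂ :=
  if i = 1 then q ^ (-(s.entry 1 : ℤ))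
  else q ^ (-(s.entry i : ℤ)) * (1 + q ^ (s.entry (i - 1) + s.entry i))

/-- The summand without the binomial factors:
`q^{s_1² + ⋯ + s_k² + s_{k-r+1} + ⋯ + s_k}` divided by
`(q)_{s_1 - s_2} ⋯ (q)_{s_{k-1} - s_k} (q²; q²)_{s_k}`. -/
def bressoudTerm {k : ℕ} (q : ℂ) (r : ℕ) (s : DecTuple k) : ℂ :=
  q ^ (∑ i ∈ Icc 1 k, s.entry i ^ 2 + ∑ i ∈ Icc (k - r + 1) k, s.entry i) /
    ((∏ i ∈ Ico 1 k, qPoch q q (s.entry i - s.entry (i + 1))) *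
      qPoch (q ^ 2) (q ^ 2) (s.entry k))

/-- The product side: `∑_{s=0}^{j} C(j,s)
(q^{k+1-r+j-2s}, q^{k+1+r-j+2s}, q^{2k+2}; q^{2k+2})_∞ / (q; q)_∞`. -/
def bressoudProductSide (q : ℂ) (k j r : ℕ) : ℂ :=
  ∑ s ∈ range (j + 1), (j.choose s : ℂ) *
    (qPochInf (q ^ ((k : ℤ) + 1 - r + j - 2 * s)) (q ^ (2 * k + 2)) *
      qPochInf (q ^ ((k : ℤ) + 1 + r - j + 2 * s)) (q ^ (2 * k + 2)) *
      qPochInf (q ^ (2 * k + 2)) (q ^ (2 * k + 2)) / qPochInf q q)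

end

/-! The proof runs a bilateral Bailey chain: `β m = ∑ α n / ((q)_{m-n} (q)_{m+n})`, with `n` over
all integers. The innermost pair is `α n = (-1)^n q^{n²}`, `β m = 1/(q²;q²)_m` (`tsum_gauss`).
Summing `β` against `q^{s²}/(q)_{m-s}` multiplies `α` by `q^{n²}`. An extra `q^{-s} (1 + q^{m+s})`
contributes a further `q^n + q^{-n}` (`tsum_binomial_baileyKernel`), and an extra `q^s` contributes
`q^n`, provided that the pair is also one relative to `q`. That proviso holds through the innermost
`r` levels because `α n * q^n` is antisymmetric under `n ↦ -n - 1` (`baileyBeta_eq_kernel'`).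

After `k` steps `α n` is `(-1)^n q^{(k+1)n² + rn} (q^n + q^{-n})^j`. The binomial factors commute,
so only the number of levels carrying one matters, which is why every admissible `S` gives the same
sum. Letting the outermost index tend to infinity (`hasSum_top_chainTerm`) turns `1 + q^{m+s_1}`
into `1` and leaves `∑ α n / (q)_∞`. Expanding the `j`-th power and applying the Jacobi triple
product to each term (`hasSum_baileyAlpha`) gives the product side. -/

noncomputable section

/-! ### Reciprocal q-factorials at integers and the q-Vandermonde sum -/

/-- The reciprocal `1 / (q; q)_n`, extended by zero to negative integers `n`. -/
def invPoch (q : ℂ) (n : ℤ) : ℂ := if 0 ≤ n then (qPoch q q n.toNat)⁻¹ else 0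

theorem invPoch_of_neg (q : ℂ) {n : ℤ} (hn : n < 0) : invPoch q n = 0 := by
  simp [invPoch, not_le.mpr hn]

theorem invPoch_natCast (q : ℂ) (n : ℕ) : invPoch q n = (qPoch q q n)⁻¹ := by
  simp [invPoch]

theorem invPoch_zero (q : ℂ) : invPoch q 0 = 1 := by
  simp [invPoch, qPoch]

theorem one_sub_ne_zero_of_norm_lt_one {z : ℂ} (hz : ‖z‖ < 1) : 1 - z ≠ 0 := by
  intro h
  rw [← sub_eq_zero.mp h] at hz
  simp at hz

theorem one_sub_pow_succ_ne_zero {q : ℂ} (hq : ‖q‖ < 1) (n : ℕ) : 1 - q ^ (n + 1) ≠ 0 := by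
  apply one_sub_ne_zero_of_norm_lt_one
  rw [norm_pow]
  exact pow_lt_one₀ (norm_nonneg q) hq n.succ_ne_zero

theorem qPoch_self_ne_zero {q : ℂ} (hq : ‖q‖ < 1) (n : ℕ) : qPoch q q n ≠ 0 := by
  rw [qPoch, prod_ne_zero_iff]
  intro i _
  rw [← pow_succ']
  exact one_sub_pow_succ_ne_zero hq i

/-- At `n = 0` both sides vanish, so the extension by zero obeys the recurrence at every integer and
later index shifts need no boundary cases. -/
theorem one_sub_mul_invPoch {q : ℂ} (hq : ‖q‖ < 1) (n : ℤ) :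
    (1 - q ^ n) * invPoch q n = invPoch q (n - 1) := by
  rcases lt_trichotomy n 0 with hn | rfl | hn
  · rw [invPoch_of_neg q hn, invPoch_of_neg q (by omega), mul_zero]
  · rw [invPoch_of_neg q (show (0 : ℤ) - 1 < 0 by norm_num)]
    simp
  · obtain ⟨m, rfl⟩ : ∃ m : ℕ, n = ((m + 1 : ℕ) : ℤ) := ⟨n.toNat - 1, by omega⟩
    rw [invPoch_natCast, show (((m + 1 : ℕ) : ℤ) - 1) = (m : ℕ) by push_cast; ring,
      invPoch_natCast, zpow_natCast]
    have h1 := one_sub_pow_succ_ne_zero hq m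
    have h2 := qPoch_self_ne_zero hq m
    have h3 : qPoch q q (m + 1) = qPoch q q m * (1 - q ^ (m + 1)) := by
      rw [qPoch, prod_range_succ, ← pow_succ', qPoch]
    rw [h3]
    field_simp

theorem invPoch_succ_mul {q : ℂ} (hq : ‖q‖ < 1) (n : ℤ) :
    (1 - q ^ (n + 1)) * invPoch q (n + 1) = invPoch q n := by
  simpa using one_sub_mul_invPoch hq (n + 1)

theorem summable_of_eq_zero_of_lt_abs {f : ℤ → ℂ} (M : ℤ) (h : ∀ n, M < |n| → f n = 0) :
    Summable f := by
  apply summable_of_hasFiniteSupport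
  apply (Set.finite_Icc (-M) M).subset
  intro n hn
  by_contra hc
  refine hn (h n ?_)
  rw [Set.mem_Icc, ← abs_le] at hc
  exact not_le.mp hc

/-- The `q`-Vandermonde sum, with all parameters integers. -/
theorem qVandermonde_aux {q : ℂ} (hq0 : q ≠ 0) (hq : ‖q‖ < 1) (N : ℕ) : ∀ c : ℤ,
    ∑' t : ℤ, q ^ (t * (t + c)) * (invPoch q (N - t) * invPoch q t * invPoch q (t + c)) =
      invPoch q N * invPoch q (N + c) := by
  have hs : ∀ (N : ℤ) (c : ℤ) (f : ℤ → ℂ), Summable fun t : ℤ =>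
      f t * (invPoch q (N - t) * invPoch q t * invPoch q (t + c)) := by
    intro N c f
    apply summable_of_eq_zero_of_lt_abs |N|
    intro t ht
    rcases lt_abs.mp ht with h | h
    · rw [invPoch_of_neg q (n := N - t) (by have := le_abs_self N; omega)]; simp
    · rw [invPoch_of_neg q (n := t) (by have := abs_nonneg N; omega)]; simp
  induction N with
  | zero =>
    intro c
    rw [tsum_eq_single 0]
    · simp [invPoch_zero]
    · intro t ht
      rcases lt_or_gt_of_ne ht with h | h
      · rw [invPoch_of_neg q h]; simp
      · rw [invPoch_of_neg q (n := ((0 : ℕ) : ℤ) - t) (by push_cast; omega)]; simp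
  | succ N ih =>
    intro c
    have hne : (1 : ℂ) - q ^ ((N : ℤ) + 1) ≠ 0 := by
      exact_mod_cast one_sub_pow_succ_ne_zero hq N
    apply mul_left_cancel₀ hne
    have hshift := (Equiv.subRight (1 : ℤ)).tsum_eq fun u : ℤ => q ^ (u * (u + (c + 1))) *
      (invPoch q (N - u) * invPoch q u * invPoch q (u + (c + 1)))
    have hss : Summable fun t : ℤ => q ^ ((t - 1) * (t - 1 + (c + 1))) *
        (invPoch q (N - (t - 1)) * invPoch q (t - 1) * invPoch q (t - 1 + (c + 1))) :=
      (Equiv.subRight (1 : ℤ)).summable_iff.mpr (hs N (c + 1) fun u => q ^ (u * (u + (c + 1))))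
    simp only [Equiv.subRight_apply] at hshift
    rw [ih (c + 1)] at hshift
    -- Split `1 - q^{N+1} = (1 - q^{N+1-t}) + q^{N+1-t} (1 - q^t)`. The first part lowers
    -- `(q)_{N+1-t}`; the second lowers `(q)_t`, giving the sum for `c + 1` after a shift of `t`.
    -- Hence the induction must cover all `c` at once.
    have key : ∀ t : ℤ, (1 - q ^ ((N : ℤ) + 1)) * (q ^ (t * (t + c)) *
        (invPoch q (((N + 1 : ℕ) : ℤ) - t) * invPoch q t * invPoch q (t + c))) =
        q ^ (t * (t + c)) * (invPoch q (N - t) * invPoch q t * invPoch q (t + c)) +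
        q ^ ((N : ℤ) + 1 + c) * (q ^ ((t - 1) * (t - 1 + (c + 1))) *
        (invPoch q (N - (t - 1)) * invPoch q (t - 1) * invPoch q (t - 1 + (c + 1)))) := by
      intro t
      have e1 := one_sub_mul_invPoch hq t
      have e2 := invPoch_succ_mul hq (N - t)
      rw [← e1, ← e2, show ((N + 1 : ℕ) : ℤ) - t = N - t + 1 by push_cast; ring,
        show (N : ℤ) - (t - 1) = N - t + 1 by ring, show t - 1 + (c + 1) = t + c by ring,
        show (t - 1) * (t + c) = t * (t + c) - t - c by ring]
      have h1 : q ^ ((N : ℤ) + 1) = q ^ ((N : ℤ) - t + 1) * q ^ t := by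
        rw [← zpow_add₀ hq0]; congr 1; ring
      have h2 : q ^ ((N : ℤ) + 1 + c) * q ^ (t * (t + c) - t - c) =
          q ^ (t * (t + c)) * q ^ ((N : ℤ) - t + 1) := by
        rw [← zpow_add₀ hq0, ← zpow_add₀ hq0]; congr 1; ring
      rw [← mul_assoc (q ^ ((N : ℤ) + 1 + c)), h2, h1]
      ring
    rw [← tsum_mul_left]
    simp_rw [key]
    rw [(hs N c _).tsum_add (hss.mul_left _), tsum_mul_left, hshift, ih c]
    have e1 := invPoch_succ_mul hq N
    have e2 := invPoch_succ_mul hq (N + c)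
    push_cast
    rw [← e2, ← mul_assoc, ← e1, show (N : ℤ) + c + 1 = N + 1 + c by ring,
      show (N : ℤ) + (c + 1) = N + 1 + c by ring]
    ring

theorem qVandermonde {q : ℂ} (hq0 : q ≠ 0) (hq : ‖q‖ < 1) (N c : ℤ) :
    ∑' t : ℤ, q ^ (t * (t + c)) * (invPoch q (N - t) * invPoch q t * invPoch q (t + c)) =
      invPoch q N * invPoch q (N + c) := by
  rcases lt_or_ge N 0 with hN | hN
  · rw [invPoch_of_neg q hN, zero_mul]
    convert tsum_zero with t
    rcases lt_or_ge t 0 with h | h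
    · rw [invPoch_of_neg q h]; simp
    · rw [invPoch_of_neg q (n := N - t) (by omega)]; simp
  · lift N to ℕ using hN
    exact qVandermonde_aux hq0 hq N c

theorem summable_invPoch_triple (q : ℂ) (m x y : ℤ) (f : ℤ → ℂ) : Summable fun s : ℤ =>
    f s * (invPoch q (m - s) * invPoch q (s - x) * invPoch q (s + y)) := by
  apply summable_of_eq_zero_of_lt_abs (|m| + |x|)
  intro s hs
  have := le_abs_self m
  have := neg_abs_le x
  have := abs_nonneg x
  have := abs_nonneg m
  rcases lt_abs.mp hs with h | h
  · rw [invPoch_of_neg q (n := m - s) (by omega)]; simp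
  · rw [invPoch_of_neg q (n := s - x) (by omega)]; simp

theorem tsum_invPoch_triple {q : ℂ} (hq0 : q ≠ 0) (hq : ‖q‖ < 1) (m x y : ℤ) :
    ∑' s : ℤ, q ^ ((s - x) * (s + y)) *
        (invPoch q (m - s) * invPoch q (s - x) * invPoch q (s + y)) =
      invPoch q (m - x) * invPoch q (m + y) := by
  rw [← (Equiv.addRight x).tsum_eq]
  have h := qVandermonde hq0 hq (m - x) (x + y)
  rw [show m - x + (x + y) = m + y by ring] at h
  rw [← h]
  refine tsum_congr fun t => ?_
  simp only [Equiv.coe_addRight]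
  rw [show t + x - x = t by ring, show t + x + y = t + (x + y) by ring,
    show m - (t + x) = m - x - t by ring]

/-! ### Bailey kernels and the steps of the chain -/

/-- The kernel `1 / ((q)_{m-n} (q)_{m+n})` of a Bailey pair relative to `1`. -/
def baileyKernel (q : ℂ) (m n : ℤ) : ℂ := invPoch q (m - n) * invPoch q (m + n)

/-- The kernel `1 / ((q)_{m-n} (q)_{m+n+1})` of a Bailey pair relative to `q`. -/
def baileyKernel' (q : ℂ) (m n : ℤ) : ℂ := invPoch q (m - n) * invPoch q (m + n + 1)

theorem baileyKernel_eq_zero (q : ℂ) {m n : ℤ} (h : m < |n|) : baileyKernel q m n = 0 := by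
  rcases lt_abs.mp h with h | h
  · rw [baileyKernel, invPoch_of_neg q (n := m - n) (by omega), zero_mul]
  · rw [baileyKernel, invPoch_of_neg q (n := m + n) (by omega), mul_zero]

theorem baileyKernel'_eq_zero (q : ℂ) {m n : ℤ} (h : m + 1 < |n|) : baileyKernel' q m n = 0 := by
  rcases lt_abs.mp h with h | h
  · rw [baileyKernel', invPoch_of_neg q (n := m - n) (by omega), zero_mul]
  · rw [baileyKernel', invPoch_of_neg q (n := m + n + 1) (by omega), mul_zero]

theorem summable_mul_baileyKernel (q : ℂ) (α : ℤ → ℂ) (m : ℤ) :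
    Summable fun n => α n * baileyKernel q m n :=
  summable_of_eq_zero_of_lt_abs m fun n hn => by rw [baileyKernel_eq_zero q hn, mul_zero]

theorem summable_mul_baileyKernel' (q : ℂ) (α : ℤ → ℂ) (m : ℤ) :
    Summable fun n => α n * baileyKernel' q m n :=
  summable_of_eq_zero_of_lt_abs (m + 1) fun n hn => by rw [baileyKernel'_eq_zero q hn, mul_zero]

theorem baileyKernel_neg (q : ℂ) (m n : ℤ) : baileyKernel q m (-n) = baileyKernel q m n := by
  rw [baileyKernel, baileyKernel, mul_comm, sub_neg_eq_add, ← sub_eq_add_neg]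

theorem baileyKernel'_neg_sub_one (q : ℂ) (m n : ℤ) :
    baileyKernel' q m (-n - 1) = baileyKernel' q m n := by
  rw [baileyKernel', baileyKernel', mul_comm]
  congr 2 <;> ring

theorem baileyKernel_eq {q : ℂ} (hq : ‖q‖ < 1) (m n : ℤ) :
    baileyKernel q m n = (1 - q ^ (m + n + 1)) * baileyKernel' q m n := by
  rw [baileyKernel, baileyKernel', ← invPoch_succ_mul hq (m + n)]
  ring

/-- Since `s² = n² + (s - n)(s + n)`, this is q-Vandermonde with `q^{n²}` taken out. -/
theorem tsum_baileyKernel {q : ℂ} (hq0 : q ≠ 0) (hq : ‖q‖ < 1) (m n : ℤ) :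
    ∑' s : ℤ, q ^ (s ^ 2) * invPoch q (m - s) * baileyKernel q s n =
      q ^ (n ^ 2) * baileyKernel q m n := by
  rw [baileyKernel, ← tsum_invPoch_triple hq0 hq m n n, ← tsum_mul_left]
  refine tsum_congr fun s => ?_
  rw [baileyKernel, ← mul_assoc (q ^ (n ^ 2)), ← zpow_add₀ hq0,
    show n ^ 2 + (s - n) * (s + n) = s ^ 2 by ring]
  ring

theorem tsum_baileyKernel' {q : ℂ} (hq0 : q ≠ 0) (hq : ‖q‖ < 1) (m n : ℤ) :
    ∑' s : ℤ, q ^ (s ^ 2 + s) * invPoch q (m - s) * baileyKernel' q s n =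
      q ^ (n ^ 2 + n) * baileyKernel' q m n := by
  rw [baileyKernel', add_assoc, ← tsum_invPoch_triple hq0 hq m n (n + 1), ← tsum_mul_left]
  refine tsum_congr fun s => ?_
  rw [baileyKernel', ← mul_assoc (q ^ (n ^ 2 + n)), ← zpow_add₀ hq0,
    show n ^ 2 + n + (s - n) * (s + (n + 1)) = s ^ 2 + s by ring, ← add_assoc]
  ring

/-- The step of the Bailey chain with a binomial factor. -/
theorem tsum_binomial_baileyKernel {q : ℂ} (hq0 : q ≠ 0) (hq : ‖q‖ < 1) (m n : ℤ) :
    ∑' s : ℤ, q ^ (s ^ 2) * (q ^ (-s) * (1 + q ^ (m + s))) * invPoch q (m - s) *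
        baileyKernel q s n =
      q ^ (n ^ 2) * (q ^ n + q ^ (-n)) * baileyKernel q m n := by
  -- Writing `1/(q)_{s-n-1} = (1 - q^{s-n})/(q)_{s-n}` splits the summand into two Vandermonde
  -- summands. Their values recombine through `q^n (1 - q^{m-n}) + q^{-n} + q^m = q^n + q^{-n}`.
  have key : ∀ s : ℤ, q ^ (s ^ 2) * (q ^ (-s) * (1 + q ^ (m + s))) * invPoch q (m - s) *
        baileyKernel q s n =
      q ^ (n ^ 2) * (q ^ n * (q ^ ((s - (n + 1)) * (s + n)) * (invPoch q (m - s) *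
          invPoch q (s - (n + 1)) * invPoch q (s + n))) +
        (q ^ (-n) + q ^ m) * (q ^ ((s - n) * (s + n)) * (invPoch q (m - s) *
          invPoch q (s - n) * invPoch q (s + n)))) := by
    intro s
    have e := one_sub_mul_invPoch hq (s - n)
    rw [show s - n - 1 = s - (n + 1) by ring] at e
    rw [← e, baileyKernel, show (s - (n + 1)) * (s + n) = s ^ 2 + -s + -n ^ 2 + - n by ring,
      show (s - n) * (s + n) = s ^ 2 + -n ^ 2 by ring, sub_eq_add_neg s n]
    simp only [zpow_add₀ hq0, zpow_neg]
    have := zpow_ne_zero n hq0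
    have := zpow_ne_zero s hq0
    have := zpow_ne_zero (n ^ 2) hq0
    field_simp
    ring
  simp_rw [key]
  rw [tsum_mul_left, ((summable_invPoch_triple q m (n + 1) n _).mul_left _).tsum_add
    ((summable_invPoch_triple q m n n _).mul_left _), tsum_mul_left, tsum_mul_left,
    tsum_invPoch_triple hq0 hq, tsum_invPoch_triple hq0 hq]
  have e := one_sub_mul_invPoch hq (m - n)
  rw [show m - n - 1 = m - (n + 1) by ring] at e
  rw [← e, baileyKernel, sub_eq_add_neg m n]
  simp only [zpow_add₀ hq0, zpow_neg]
  have := zpow_ne_zero n hq0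
  field_simp
  ring

/-! ### Reflection symmetries and the initial Bailey pair -/

theorem neg_one_zpow_neg (n : ℤ) : (-1 : ℂ) ^ (-n) = (-1) ^ n := by
  rw [zpow_neg, ← inv_zpow, inv_neg, inv_one]

theorem neg_one_zpow_neg_sub_one (n : ℤ) : (-1 : ℂ) ^ (-n - 1) = -(-1) ^ n := by
  rw [zpow_sub_one₀ (by norm_num), neg_one_zpow_neg, inv_neg, inv_one, mul_neg_one]

theorem neg_one_zpow_add_one (n : ℤ) : (-1 : ℂ) ^ (n + 1) = -(-1) ^ n := by
  rw [zpow_add_one₀ (by norm_num), mul_neg_one]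

theorem neg_one_zpow_sub_one (n : ℤ) : (-1 : ℂ) ^ (n - 1) = -(-1) ^ n := by
  rw [zpow_sub_one₀ (by norm_num), inv_neg, inv_one, mul_neg_one]

theorem tsum_mul_baileyKernel'_reflect (q : ℂ) (α : ℤ → ℂ) (m : ℤ) :
    ∑' n, α (-n - 1) * baileyKernel' q m n = ∑' n, α n * baileyKernel' q m n := by
  rw [← ((Equiv.neg ℤ).trans (Equiv.subRight 1)).tsum_eq fun n => α n * baileyKernel' q m n]
  refine tsum_congr fun n => ?_
  simp only [Equiv.trans_apply, Equiv.neg_apply, Equiv.subRight_apply]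
  rw [baileyKernel'_neg_sub_one]

theorem tsum_mul_baileyKernel_neg (q : ℂ) (α : ℤ → ℂ) (m : ℤ) :
    ∑' n, α (-n) * baileyKernel q m n = ∑' n, α n * baileyKernel q m n := by
  rw [← (Equiv.neg ℤ).tsum_eq fun n => α n * baileyKernel q m n]
  refine tsum_congr fun n => ?_
  simp only [Equiv.neg_apply]
  rw [baileyKernel_neg]

theorem tsum_mul_baileyKernel'_eq_zero (q : ℂ) (α : ℤ → ℂ) (m : ℤ)
    (h : ∀ n, α (-n - 1) = -α n) : ∑' n, α n * baileyKernel' q m n = 0 := by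
  have := tsum_mul_baileyKernel'_reflect q α m
  simp_rw [h, neg_mul, tsum_neg] at this
  linear_combination (-1 / 2 : ℂ) * this

theorem tsum_mul_baileyKernel_eq {q : ℂ} (hq : ‖q‖ < 1) (hq0 : q ≠ 0) (α : ℤ → ℂ) (m : ℤ) :
    ∑' n, α n * baileyKernel q m n = ∑' n, α n * baileyKernel' q m n -
      q ^ (m + 1) * ∑' n, α n * q ^ n * baileyKernel' q m n := by
  rw [← tsum_mul_left, ← (summable_mul_baileyKernel' q α m).tsum_sub
    ((summable_mul_baileyKernel' q _ m).mul_left _)]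
  refine tsum_congr fun n => ?_
  rw [baileyKernel_eq hq, show m + n + 1 = m + 1 + n by ring, zpow_add₀ hq0]
  ring

/-- The kernels differ by the factor `1 - q^{m+n+1}`. The `q^{m+n+1}` part sums to zero, since
`baileyKernel'` is invariant under `n ↦ -n - 1` while `α n * q^n` changes sign. This is the passage
between pairs relative to `1` and to `q`. -/
theorem tsum_baileyKernel_eq_baileyKernel' {q : ℂ} (hq : ‖q‖ < 1) (hq0 : q ≠ 0) (α : ℤ → ℂ)
    (m : ℤ) (h : ∀ n, α (-n - 1) * q ^ (-n - 1) = -(α n * q ^ n)) :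
    ∑' n, α n * baileyKernel q m n = ∑' n, α n * baileyKernel' q m n := by
  rw [tsum_mul_baileyKernel_eq hq hq0, tsum_mul_baileyKernel'_eq_zero q (fun n => α n * q ^ n) m h,
    mul_zero, sub_zero]

/-- After rewriting with `baileyKernel'`, antisymmetry leaves only `-q^{m+1} ∑ α n * q^{2n}` on the
left; reflecting `n ↦ -n - 1` turns it into `q^m ∑ α n`. -/
theorem tsum_gauss_shift {q : ℂ} (hq : ‖q‖ < 1) (hq0 : q ≠ 0) (m : ℤ) :
    ∑' n : ℤ, (-1) ^ n * q ^ (n ^ 2) * q ^ n * baileyKernel q m n =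
      q ^ m * ∑' n : ℤ, (-1) ^ n * q ^ (n ^ 2) * baileyKernel q m n := by
  have anti : ∀ n : ℤ, (-1 : ℂ) ^ (-n - 1) * q ^ ((-n - 1) ^ 2) * q ^ (-n - 1) =
      -((-1) ^ n * q ^ (n ^ 2) * q ^ n) := by
    intro n
    rw [neg_one_zpow_neg_sub_one, mul_assoc, mul_assoc, ← zpow_add₀ hq0, ← zpow_add₀ hq0,
      show (-n - 1) ^ 2 + (-n - 1) = n ^ 2 + n by ring]
    ring
  rw [tsum_mul_baileyKernel_eq hq hq0,
    tsum_mul_baileyKernel'_eq_zero q (fun n => (-1 : ℂ) ^ n * q ^ (n ^ 2) * q ^ n) m anti,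
    tsum_baileyKernel_eq_baileyKernel' hq hq0 (fun n : ℤ => (-1 : ℂ) ^ n * q ^ (n ^ 2)) m anti,
    ← tsum_mul_baileyKernel'_reflect, zero_sub, ← tsum_mul_left, ← tsum_mul_left, ← tsum_neg]
  refine tsum_congr fun n => ?_
  rw [anti, zpow_sub₀ hq0, zpow_neg, zpow_add₀ hq0]
  have := zpow_ne_zero n hq0
  simp only [zpow_one]
  field_simp

theorem baileyKernel_sub_one {q : ℂ} (hq : ‖q‖ < 1) (hq0 : q ≠ 0) (m n : ℤ) :
    baileyKernel q m n =
      (1 + q ^ (m + 1) * q ^ (m + 1) - q ^ (m + 1) * (q ^ n + q ^ (-n))) *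
        baileyKernel q (m + 1) n := by
  have e1 := invPoch_succ_mul hq (m - n)
  have e2 := invPoch_succ_mul hq (m + n)
  rw [baileyKernel, ← e1, ← e2, baileyKernel, show m - n + 1 = m + 1 + -n by ring,
    show m + n + 1 = m + 1 + n by ring, show m + 1 - n = m + 1 + -n by ring,
    zpow_add₀ hq0 (m + 1) (-n), zpow_add₀ hq0 (m + 1) n, zpow_neg]
  have := zpow_ne_zero n hq0
  field_simp
  ring

theorem tsum_gauss {q : ℂ} (hq : ‖q‖ < 1) (hq0 : q ≠ 0) (m : ℕ) :
    ∑' n : ℤ, (-1) ^ n * q ^ (n ^ 2) * baileyKernel q m n =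
      (qPoch (q ^ 2) (q ^ 2) m)⁻¹ := by
  induction m with
  | zero =>
    rw [tsum_eq_single 0]
    · simp [baileyKernel, invPoch_zero, qPoch]
    · intro n hn
      rw [baileyKernel_eq_zero, mul_zero]
      simpa using hn
  | succ m ih =>
    have hq2 : ‖q ^ 2‖ < 1 := by
      rw [norm_pow]
      exact pow_lt_one₀ (norm_nonneg q) hq two_ne_zero
    have hne := one_sub_pow_succ_ne_zero hq2 m
    have hP := qPoch_self_ne_zero hq2 m
    have hrec : qPoch (q ^ 2) (q ^ 2) (m + 1) =
        qPoch (q ^ 2) (q ^ 2) m * (1 - (q ^ 2) ^ (m + 1)) := by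
      rw [qPoch, prod_range_succ, ← pow_succ', qPoch]
    set α : ℤ → ℂ := fun n => (-1) ^ n * q ^ (n ^ 2) with hα
    have hneg := tsum_mul_baileyKernel_neg q (fun n => α n * q ^ n) (m + 1)
    have hαneg : ∀ n, α (-n) = α n := by
      intro n
      simp only [hα]
      rw [neg_one_zpow_neg, neg_sq]
    simp_rw [hαneg] at hneg
    have hsh := tsum_gauss_shift hq hq0 (m + 1)
    -- Both sums with `q^n` and `q^{-n}` equal `q^{m+1}` times the unweighted one, so the
    -- coefficient collapses to `1 + q^{2m+2} - 2 q^{2m+2} = 1 - q^{2m+2}`, the new factor of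
    -- `(q²;q²)_{m+1}`.
    have hsplit : ∑' n, α n * baileyKernel q m n =
        (1 + q ^ ((m : ℤ) + 1) * q ^ ((m : ℤ) + 1)) * ∑' n, α n * baileyKernel q (m + 1) n -
        q ^ ((m : ℤ) + 1) * (∑' n, α n * q ^ n * baileyKernel q (m + 1) n +
          ∑' n, α n * q ^ (-n) * baileyKernel q (m + 1) n) := by
      have s0 := summable_mul_baileyKernel q α (m + 1)
      have s1 := summable_mul_baileyKernel q (fun n => α n * q ^ n) (m + 1)
      have s2 := summable_mul_baileyKernel q (fun n => α n * q ^ (-n)) (m + 1)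
      rw [← s1.tsum_add s2, ← tsum_mul_left, ← tsum_mul_left,
        ← (s0.mul_left _).tsum_sub ((s1.add s2).mul_left _)]
      refine tsum_congr fun n => ?_
      rw [baileyKernel_sub_one hq hq0]
      ring
    rw [hneg, hsh] at hsplit
    rw [ih] at hsplit
    push_cast
    have hpow : ((q ^ 2) ^ (m + 1) : ℂ) = q ^ ((m : ℤ) + 1) * q ^ ((m : ℤ) + 1) := by
      rw [← zpow_add₀ hq0, ← pow_mul, ← zpow_natCast]
      congr 1
      push_cast
      ring
    rw [hpow] at hne
    have hmul : (∑' n, α n * baileyKernel q (m + 1) n) *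
        (1 - q ^ ((m : ℤ) + 1) * q ^ ((m : ℤ) + 1)) = (qPoch (q ^ 2) (q ^ 2) m)⁻¹ := by
      rw [hsplit]
      ring
    rw [hrec, hpow, mul_inv, ← hmul, mul_assoc, mul_inv_cancel₀ hne, mul_one]

/-! ### The finite triple product -/

/-- The algebraic core of the induction for `tsum_finite_triple_product`: with `Q = p²`, read `v =
Q^m`, `w = Q^n`, `A = α n`, and `E₁`, `E₂` as `1/(Q)_{m-n+1}`, `1/(Q)_{m+n+1}`. -/
theorem triple_product_recurrence {x w : ℂ} (hx : x ≠ 0) (hw : w ≠ 0) (p v A E₁ E₂ : ℂ) :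
    (1 - v ^ 2 * p ^ 2) * (1 - v ^ 2 * p ^ 2 * p ^ 2) * (A * (E₁ * E₂)) =
      (1 + p ^ 2 * v ^ 2) * (A * ((1 - v / w * p ^ 2) * E₁ * ((1 - v * w * p ^ 2) * E₂))) -
      p * v * x * (-A * (p * w⁻¹ * x⁻¹) *
        (E₁ * ((1 - v * w) * ((1 - v * w * p ^ 2) * E₂)))) -
      p * v * x⁻¹ * (-A * (p * w * x) *
        ((1 - v / w) * ((1 - v / w * p ^ 2) * E₁) * E₂)) := by
  field_simp
  ring

theorem summable_int_add {f : ℤ → ℂ} (hf : Summable f) (c : ℤ) : Summable fun n => f (n + c) :=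
  (Equiv.addRight c).summable_iff.mpr hf

theorem summable_int_sub {f : ℤ → ℂ} (hf : Summable f) (c : ℤ) : Summable fun n => f (n - c) :=
  (Equiv.subRight c).summable_iff.mpr hf

theorem tsum_int_add (f : ℤ → ℂ) (c : ℤ) : ∑' n, f (n + c) = ∑' n, f n :=
  (Equiv.addRight c).tsum_eq f

theorem tsum_int_sub (f : ℤ → ℂ) (c : ℤ) : ∑' n, f (n - c) = ∑' n, f n :=
  (Equiv.subRight c).tsum_eq f

/-- The finite form of the Jacobi triple product. -/
theorem tsum_finite_triple_product {p x : ℂ} (hp0 : p ≠ 0) (hp : ‖p ^ 2‖ < 1) (hx : x ≠ 0)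
    (m : ℕ) :
    ∑' n : ℤ, (-1) ^ n * p ^ (n ^ 2) * x ^ n * baileyKernel (p ^ 2) m n =
      qPoch (p / x) (p ^ 2) m * qPoch (p * x) (p ^ 2) m * invPoch (p ^ 2) (2 * m : ℕ) := by
  have hQ0 : p ^ 2 ≠ 0 := pow_ne_zero 2 hp0
  induction m with
  | zero =>
    rw [tsum_eq_single 0]
    · simp [baileyKernel, invPoch_zero, qPoch]
    · intro n hn
      rw [baileyKernel_eq_zero, mul_zero]
      simpa using hn
  | succ m ih =>
    set Q := p ^ 2 with hQ
    set α : ℤ → ℂ := fun n => (-1) ^ n * p ^ (n ^ 2) * x ^ n with hα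
    have key : ∀ n : ℤ, (1 - Q ^ (2 * m + 1)) * (1 - Q ^ (2 * m + 2)) *
        (α n * baileyKernel Q (m + 1) n) =
        (1 + p ^ 2 * Q ^ (2 * m)) * (α n * baileyKernel Q m n) -
        p * Q ^ m * x * (α (n - 1) * baileyKernel Q m (n - 1)) -
        p * Q ^ m * x⁻¹ * (α (n + 1) * baileyKernel Q m (n + 1)) := by
      intro n
      have a1 := invPoch_succ_mul hp (m - n)
      have a0 := one_sub_mul_invPoch hp (m - n)
      have b1 := invPoch_succ_mul hp (m + n)
      have b0 := one_sub_mul_invPoch hp (m + n)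
      have c1 : α (n - 1) = -α n * (p * p ^ (-2 * n) * x⁻¹) := by
        simp only [hα]
        rw [neg_one_zpow_sub_one, zpow_sub_one₀ hx,
          show (n - 1) ^ 2 = n ^ 2 + 1 + -2 * n by ring, zpow_add₀ hp0, zpow_add₀ hp0, zpow_one]
        ring
      have c2 : α (n + 1) = -α n * (p * p ^ (2 * n) * x) := by
        simp only [hα]
        rw [neg_one_zpow_add_one, zpow_add_one₀ hx,
          show (n + 1) ^ 2 = n ^ 2 + 1 + 2 * n by ring, zpow_add₀ hp0, zpow_add₀ hp0, zpow_one]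
        ring
      simp only [baileyKernel]
      rw [c1, c2, show (m : ℤ) - (n - 1) = m - n + 1 by ring,
        show (m : ℤ) + (n - 1) = m + n - 1 by ring, show (m : ℤ) - (n + 1) = m - n - 1 by ring,
        show (m : ℤ) + (n + 1) = m + n + 1 by ring, show (m : ℤ) + 1 - n = m - n + 1 by ring,
        show (m : ℤ) + 1 + n = m + n + 1 by ring, ← a0, ← b0, ← a1, ← b1]
      have d1 : p ^ (2 * n) = Q ^ n := by rw [zpow_mul]; rfl
      have d2 : p ^ (-2 * n) = (Q ^ n)⁻¹ := by rw [neg_mul, zpow_neg, d1]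
      rw [d1, d2, zpow_add_one₀ hQ0, zpow_add_one₀ hQ0, zpow_sub₀ hQ0, zpow_add₀ hQ0,
        zpow_natCast, pow_succ Q (2 * m), pow_succ Q (2 * m + 1), pow_succ Q (2 * m),
        pow_mul' Q 2 m]
      exact triple_product_recurrence hx (zpow_ne_zero n hQ0) p (Q ^ m) (α n) _ _
    have s0 := summable_mul_baileyKernel Q α m
    have hαn : ∀ n, (-1) ^ n * p ^ (n ^ 2) * x ^ n = α n := fun n => rfl
    simp_rw [hαn] at ih ⊢
    clear_value α
    have s1 := summable_int_sub s0 1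
    have s2 := summable_int_add s0 1
    have t1 := tsum_int_sub (fun n => α n * baileyKernel Q m n) 1
    have t2 := tsum_int_add (fun n => α n * baileyKernel Q m n) 1
    have n1 := one_sub_pow_succ_ne_zero hp (2 * m)
    have n2 := one_sub_pow_succ_ne_zero hp (2 * m + 1)
    -- The shifts by `±1` do not change the sums over all integers, and `1 + p² Q^{2m} - p Q^m (x +
    -- x⁻¹)` factors into the next two factors of the product side.
    have hsum : (1 - Q ^ (2 * m + 1)) * (1 - Q ^ (2 * m + 2)) *
        ∑' n, α n * baileyKernel Q (m + 1) n =
        (1 - p / x * Q ^ m) * (1 - p * x * Q ^ m) * ∑' n, α n * baileyKernel Q m n := by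
      rw [← tsum_mul_left]
      simp_rw [key]
      rw [((s0.mul_left _).sub (s1.mul_left _)).tsum_sub (s2.mul_left _),
        (s0.mul_left _).tsum_sub (s1.mul_left _), tsum_mul_left, tsum_mul_left, tsum_mul_left,
        t1, t2, pow_mul' Q 2 m]
      field_simp
      ring
    rw [ih] at hsum
    push_cast at hsum ⊢
    apply mul_left_cancel₀ (mul_ne_zero n1 n2)
    rw [hsum]
    have e1 := invPoch_succ_mul hp (2 * m : ℤ)
    have e2 := invPoch_succ_mul hp (2 * m + 1 : ℤ)
    rw [← e2] at e1
    rw [← e1, show (2 * ((m : ℤ) + 1)) = 2 * m + 1 + 1 by ring, qPoch, qPoch, qPoch, qPoch,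
      prod_range_succ, prod_range_succ]
    rw [show (2 * m + 1 + 1 : ℤ) = ((2 * m + 1 + 1 : ℕ) : ℤ) by push_cast; ring,
      show (2 * m + 1 : ℤ) = ((2 * m + 1 : ℕ) : ℤ) by push_cast; ring, zpow_natCast, zpow_natCast]
    ring

/-! ### Limits of Bailey sums and the Jacobi triple product -/

theorem qPochInf_self_ne_zero {q : ℂ} (hq : ‖q‖ < 1) : qPochInf q q ≠ 0 := by
  have h : Summable fun i : ℕ => ‖-(q * q ^ i)‖ := by
    simp only [norm_neg, norm_mul, norm_pow]
    exact (summable_geometric_of_lt_one (norm_nonneg q) hq).mul_left ‖q‖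
  have := tprod_one_add_ne_zero_of_summable (f := fun i : ℕ => -(q * q ^ i)) (fun i => by
    rw [← sub_eq_add_neg, ← pow_succ']
    exact one_sub_pow_succ_ne_zero hq i) h
  simpa only [qPochInf, sub_eq_add_neg] using this

theorem tendsto_qPoch (A : ℂ) {q : ℂ} (hq : ‖q‖ < 1) :
    Filter.Tendsto (qPoch A q) Filter.atTop (nhds (qPochInf A q)) :=
  (multipliable_qPochInf A q hq).hasProd.tendsto_prod_nat

theorem tendsto_invPoch_natCast {q : ℂ} (hq : ‖q‖ < 1) :
    Filter.Tendsto (fun n : ℕ => invPoch q n) Filter.atTop (nhds (qPochInf q q)⁻¹) := by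
  simp_rw [invPoch_natCast]
  exact (tendsto_qPoch q hq).inv₀ (qPochInf_self_ne_zero hq)

theorem tendsto_invPoch_add {q : ℂ} (hq : ‖q‖ < 1) (c : ℤ) :
    Filter.Tendsto (fun n : ℕ => invPoch q (n + c)) Filter.atTop (nhds (qPochInf q q)⁻¹) := by
  have h : Filter.Tendsto (fun n : ℕ => ((n : ℤ) + c).toNat) Filter.atTop Filter.atTop := by
    rw [Filter.tendsto_atTop]
    intro b
    filter_upwards [Filter.eventually_ge_atTop (b + c.natAbs)] with n hn
    omega
  refine ((tendsto_invPoch_natCast hq).comp h).congr' ?_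
  filter_upwards [Filter.eventually_ge_atTop c.natAbs] with n hn
  simp only [Function.comp_apply]
  rw [Int.toNat_of_nonneg (by omega)]

theorem tendsto_invPoch_sub {q : ℂ} (hq : ‖q‖ < 1) (c : ℤ) :
    Filter.Tendsto (fun n : ℕ => invPoch q (n - c)) Filter.atTop (nhds (qPochInf q q)⁻¹) := by
  simpa only [sub_eq_add_neg] using tendsto_invPoch_add hq (-c)

theorem exists_norm_invPoch_le {q : ℂ} (hq : ‖q‖ < 1) :
    ∃ C : ℝ, 0 ≤ C ∧ ∀ n, ‖invPoch q n‖ ≤ C := by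
  obtain ⟨C, hC⟩ := (tendsto_invPoch_natCast hq).norm.bddAbove_range
  have h0 : 0 ≤ C := (norm_nonneg _).trans (hC ⟨0, rfl⟩)
  refine ⟨C, h0, fun n => ?_⟩
  rcases lt_or_ge n 0 with hn | hn
  · rw [invPoch_of_neg q hn, norm_zero]
    exact h0
  · lift n to ℕ using hn
    exact hC ⟨n, rfl⟩

theorem tendsto_tsum_mul_baileyKernel {q : ℂ} (hq : ‖q‖ < 1) {α : ℤ → ℂ} (hα : Summable α) :
    Filter.Tendsto (fun m : ℕ => ∑' n, α n * baileyKernel q m n) Filter.atTop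
      (nhds ((∑' n, α n) * ((qPochInf q q)⁻¹ * (qPochInf q q)⁻¹))) := by
  obtain ⟨C, hC0, hC⟩ := exists_norm_invPoch_le hq
  rw [← tsum_mul_right]
  apply tendsto_tsum_of_dominated_convergence (bound := fun n => ‖α n‖ * (C * C))
    (hα.norm.mul_right _)
  · intro n
    exact ((tendsto_invPoch_sub hq n).mul (tendsto_invPoch_add hq n)).const_mul _
  · refine Filter.Eventually.of_forall fun m n => ?_
    rw [norm_mul, baileyKernel, norm_mul]
    gcongr
    · exact hC _
    · exact hC _

theorem summable_pow_sq_mul_pow {p : ℂ} (hp : ‖p‖ < 1) (x : ℂ) :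
    Summable fun n : ℕ => p ^ (n ^ 2) * x ^ n := by
  have ht : Filter.Tendsto (fun n : ℕ => ‖p ^ n * x‖) Filter.atTop (nhds 0) := by
    simpa using ((tendsto_pow_atTop_nhds_zero_of_norm_lt_one hp).mul_const x).norm
  -- The term is `(p^n x)^n`, and `‖p^n x‖ ≤ 1/2` eventually.
  refine (summable_geometric_of_lt_one (r := 1 / 2) (by norm_num)
    (by norm_num)).of_norm_bounded_eventually_nat ?_
  filter_upwards [ht.eventually_le_const (show (0 : ℝ) < 1 / 2 by norm_num)] with n hn
  rw [sq, pow_mul, ← mul_pow, norm_pow]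
  exact pow_le_pow_left₀ (norm_nonneg _) hn n

theorem summable_zpow_sq_mul_zpow {p : ℂ} (hp : ‖p‖ < 1) (x : ℂ) :
    Summable fun n : ℤ => (-1) ^ n * p ^ (n ^ 2) * x ^ n := by
  apply Summable.of_norm
  simp only [norm_mul, norm_zpow, norm_neg, norm_one, one_zpow, one_mul]
  apply Summable.of_nat_of_neg
  · refine (summable_pow_sq_mul_pow hp x).norm.congr fun n => ?_
    rw [norm_mul, norm_pow, norm_pow, zpow_natCast, ← zpow_natCast]
    push_cast
    rfl
  · refine (summable_pow_sq_mul_pow hp x⁻¹).norm.congr fun n => ?_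
    rw [norm_mul, norm_pow, norm_pow, norm_inv, zpow_neg, zpow_natCast, inv_pow, neg_sq,
      ← zpow_natCast]
    push_cast
    rfl

/-- The Jacobi triple product identity. -/
theorem hasSum_jacobi_triple_product {p x : ℂ} (hp0 : p ≠ 0) (hp : ‖p‖ < 1) (hx : x ≠ 0) :
    HasSum (fun n : ℤ => (-1) ^ n * p ^ (n ^ 2) * x ^ n)
      (qPochInf (p / x) (p ^ 2) * qPochInf (p * x) (p ^ 2) * qPochInf (p ^ 2) (p ^ 2)) := by
  have hp2 : ‖p ^ 2‖ < 1 := by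
    rw [norm_pow]
    exact pow_lt_one₀ (norm_nonneg p) hp two_ne_zero
  have hs := summable_zpow_sq_mul_zpow hp x
  have h1 := tendsto_tsum_mul_baileyKernel hp2 hs
  simp_rw [tsum_finite_triple_product hp0 hp2 hx] at h1
  have hdouble : Filter.Tendsto (fun m : ℕ => 2 * m) Filter.atTop Filter.atTop :=
    Filter.tendsto_id.const_mul_atTop' two_pos
  have h2 := ((tendsto_qPoch (p / x) hp2).mul (tendsto_qPoch (p * x) hp2)).mul
    ((tendsto_invPoch_natCast hp2).comp hdouble)
  have h3 := tendsto_nhds_unique h1 h2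
  have hne := qPochInf_self_ne_zero hp2
  convert hs.hasSum using 1
  field_simp at h3
  rw [h3]
  ring

/-! ### Iterated sums along chains -/

/-- The product of weights along the sequence `m, s 0, s 1, …`, closed off by the weight `β`
of its last entry; the weights `w` are indexed by the distance to the last entry. -/
def chainTerm (w : ℕ → ℕ → ℕ → ℂ) (β : ℕ → ℂ) : (k : ℕ) → ℕ → (Fin k → ℕ) → ℂ
  | 0, m, _ => β m
  | k + 1, m, s => w k m (s 0) * chainTerm w β k (s 0) (Fin.tail s)

theorem summable_prod_pi {g : ℕ → ℝ} (hg : Summable g) (hg0 : ∀ a, 0 ≤ g a) (k : ℕ) :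
    Summable fun s : Fin k → ℕ => ∏ i, g (s i) := by
  induction k with
  | zero => exact (hasSum_fintype _).summable
  | succ k ih =>
    rw [← (Fin.consEquiv fun _ : Fin (k + 1) => ℕ).summable_iff]
    refine (hg.mul_of_nonneg ih hg0 fun s => prod_nonneg fun i _ => hg0 _).congr fun x => ?_
    simp [Fin.prod_univ_succ, Fin.consEquiv]

theorem norm_chainTerm_le {w : ℕ → ℕ → ℕ → ℂ} {β : ℕ → ℂ} {g : ℕ → ℝ} {C : ℝ}
    (hg0 : ∀ a, 0 ≤ g a) (hw : ∀ d m a, ‖w d m a‖ ≤ g a) (hβ : ∀ m, ‖β m‖ ≤ C) (k : ℕ) :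
    ∀ m s, ‖chainTerm w β k m s‖ ≤ C * ∏ i, g (s i) := by
  induction k with
  | zero => intro m s; simpa [chainTerm] using hβ m
  | succ k ih =>
    intro m s
    rw [chainTerm, norm_mul, Fin.prod_univ_succ, mul_left_comm]
    exact mul_le_mul (hw _ _ _) (ih _ _) (norm_nonneg _) (hg0 _)

/-- The bound on `F a` is uniform in `a`, so `C * ∏ g` dominates the whole family and the sum may be
taken one coordinate at a time. -/
theorem hasSum_pi_cons {k : ℕ} {v : ℕ → ℂ} {F : ℕ → (Fin k → ℕ) → ℂ} {B : ℕ → ℂ} {g : ℕ → ℝ}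
    {C : ℝ} (hg : Summable g) (hg0 : ∀ a, 0 ≤ g a) (hv : ∀ a, ‖v a‖ ≤ g a)
    (hF : ∀ a s, ‖F a s‖ ≤ C * ∏ i, g (s i)) (hB : ∀ a, HasSum (F a) (B a)) :
    HasSum (fun s : Fin (k + 1) → ℕ => v (s 0) * F (s 0) (Fin.tail s)) (∑' a, v a * B a) := by
  rw [← (Fin.consEquiv fun _ : Fin (k + 1) => ℕ).hasSum_iff]
  have hs : Summable fun x : ℕ × (Fin k → ℕ) => v x.1 * F x.1 x.2 := by
    refine Summable.of_norm_bounded (g := fun x : ℕ × (Fin k → ℕ) => C * (g x.1 * ∏ i, g (x.2 i)))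
      ((hg.mul_of_nonneg (summable_prod_pi hg hg0 k)
        hg0 fun s => prod_nonneg fun i _ => hg0 _).mul_left C) fun x => ?_
    rw [norm_mul, mul_left_comm]
    exact mul_le_mul (hv _) (hF _ _) (norm_nonneg _) (hg0 _)
  have h := hs.hasSum.prod_fiberwise fun a => (hB a).mul_left (v a)
  rw [h.tsum_eq]
  exact hs.hasSum

theorem hasSum_chainTerm {w : ℕ → ℕ → ℕ → ℂ} {B : ℕ → ℕ → ℂ} {g : ℕ → ℝ} {C : ℝ}
    (hg : Summable g) (hg0 : ∀ a, 0 ≤ g a) (hw : ∀ d m a, ‖w d m a‖ ≤ g a)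
    (hβ : ∀ m, ‖B 0 m‖ ≤ C) (hB : ∀ d m, ∑' a, w d m a * B d a = B (d + 1) m) (k : ℕ) :
    ∀ m, HasSum (chainTerm w (B 0) k m) (B k m) := by
  induction k with
  | zero => intro m; exact hasSum_unique _
  | succ k ih =>
    intro m
    have h := hasSum_pi_cons hg hg0 (hw k m) (norm_chainTerm_le hg0 hw hβ k) ih
    rw [hB] at h
    exact h

/-! ### The Bailey chain of the theorem -/

theorem tsum_natCast_eq {f : ℤ → ℂ} (hf : ∀ n < 0, f n = 0) : ∑' n : ℕ, f n = ∑' n, f n := by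
  refine Nat.cast_injective.tsum_eq fun n hn => ?_
  have : 0 ≤ n := by
    by_contra h
    exact hn (hf n (not_le.mp h))
  exact ⟨n.toNat, Int.toNat_of_nonneg this⟩

/-- A kernel identity turns one Bailey pair into another. -/
theorem tsum_kernel_step {q : ℂ} {K : ℤ → ℤ → ℂ} {W μ α : ℤ → ℂ} {m : ℕ}
    (hK : ∀ s n, s < 0 → K s n = 0) (hs : ∀ s, Summable fun n => α n * K s n)
    (h : ∀ n, ∑' s : ℤ, W s * invPoch q (m - s) * K s n = μ n * K m n) :
    ∑' a : ℕ, W a * invPoch q ((m : ℤ) - a) * ∑' n, α n * K a n =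
      ∑' n, α n * μ n * K m n := by
  -- The factor `1/(q)_{m-a}` makes the sum over `a` finite, so it may be exchanged with the sum
  -- over `n`.
  have hz : ∀ a ∉ range (m + 1), invPoch q ((m : ℤ) - (a : ℕ)) = 0 := by
    intro a ha
    rw [mem_range] at ha
    exact invPoch_of_neg q (by omega)
  rw [tsum_eq_sum (s := range (m + 1)) fun a ha => by rw [hz a ha]; simp]
  simp_rw [← tsum_mul_left]
  rw [← Summable.tsum_finsetSum fun (a : ℕ) _ => (hs a).mul_left (W a * invPoch q (m - a))]
  refine tsum_congr fun n => ?_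
  rw [mul_assoc, ← h n, ← tsum_natCast_eq fun s hs => by rw [hK s n hs, mul_zero],
    tsum_eq_sum (s := range (m + 1)) fun a ha => by rw [hz a ha]; simp, mul_sum]
  refine sum_congr rfl fun a _ => ?_
  ring

/-- The factor that the entry `a` after `m` contributes at distance `d` from the last entry. -/
def stepFactor (q : ℂ) (r : ℕ) (T : Finset ℕ) (d m a : ℕ) : ℂ :=
  q ^ (a ^ 2) * (if d < r then q ^ a else 1) *
    (if d ∈ T then (q ^ a)⁻¹ * (1 + q ^ (m + a)) else 1)

/-- The factor that the first entry contributes. -/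
def topFactor (q : ℂ) (r : ℕ) (T : Finset ℕ) (d a : ℕ) : ℂ :=
  q ^ (a ^ 2) * (if d < r then q ^ a else 1) * (if d ∈ T then (q ^ a)⁻¹ else 1)

/-- The sequences `α` of the successive Bailey pairs. -/
def baileyAlpha (q : ℂ) (r : ℕ) (T : Finset ℕ) : ℕ → ℤ → ℂ
  | 0, n => (-1) ^ n * q ^ (n ^ 2)
  | d + 1, n => baileyAlpha q r T d n *
      (q ^ (n ^ 2) * (if d < r then q ^ n else 1) * (if d ∈ T then q ^ n + q ^ (-n) else 1))

/-- The sequences `β` of the successive Bailey pairs. -/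
def baileyBeta (q : ℂ) (r : ℕ) (T : Finset ℕ) (d m : ℕ) : ℂ :=
  ∑' n, baileyAlpha q r T d n * baileyKernel q m n

theorem baileyKernel_of_neg (q : ℂ) (m n : ℤ) (hm : m < 0) : baileyKernel q m n = 0 :=
  baileyKernel_eq_zero q (hm.trans_le (abs_nonneg n))

theorem baileyKernel'_of_neg (q : ℂ) (m n : ℤ) (hm : m < 0) : baileyKernel' q m n = 0 := by
  rcases lt_or_ge m n with h | h
  · rw [baileyKernel', invPoch_of_neg q (n := m - n) (by omega), zero_mul]
  · rw [baileyKernel', invPoch_of_neg q (n := m + n + 1) (by omega), mul_zero]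

section
variable {q : ℂ} {r : ℕ} {T : Finset ℕ}

theorem baileyAlpha_of_le (hq0 : q ≠ 0) (hT : ∀ d ∈ T, r ≤ d) {d : ℕ} (hd : d ≤ r) (n : ℤ) :
    baileyAlpha q r T d n = (-1) ^ n * q ^ ((d + 1) * n ^ 2 + d * n) := by
  induction d with
  | zero => simp [baileyAlpha]
  | succ d ih =>
    have h : d ∉ T := fun h => by have := hT d h; omega
    rw [baileyAlpha, ih (by omega), if_pos (by omega), if_neg h, mul_one, mul_assoc,
      ← zpow_add₀ hq0, ← zpow_add₀ hq0]
    push_cast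
    ring_nf

theorem baileyAlpha_of_ge (hq0 : q ≠ 0) (hT : ∀ d ∈ T, r ≤ d) {d : ℕ} (hd : r ≤ d) (n : ℤ) :
    baileyAlpha q r T d n = (-1) ^ n * q ^ ((d + 1) * n ^ 2 + r * n) *
      (q ^ n + q ^ (-n)) ^ (T.filter (· < d)).card := by
  induction d, hd using Nat.le_induction with
  | base =>
    rw [baileyAlpha_of_le hq0 hT le_rfl, filter_eq_empty_iff.mpr fun d hd => not_lt.mpr (hT d hd)]
    simp
  | succ d hd ih =>
    rw [baileyAlpha, ih, if_neg (not_lt.mpr hd),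
      show ((((d + 1 : ℕ) : ℤ) + 1) * n ^ 2 + r * n) = ((d + 1) * n ^ 2 + r * n) + n ^ 2 by
        push_cast; ring, zpow_add₀ hq0 _ (n ^ 2)]
    split_ifs with h
    · have : T.filter (· < d + 1) = insert d (T.filter (· < d)) := by
        ext x
        simp only [mem_filter, mem_insert]
        constructor
        · rintro ⟨h1, h2⟩
          by_cases hx : x = d
          · exact Or.inl hx
          · exact Or.inr ⟨h1, by omega⟩
        · rintro (rfl | ⟨h1, h2⟩)
          · exact ⟨h, by omega⟩
          · exact ⟨h1, by omega⟩
      rw [this, card_insert_of_notMem (by simp), pow_succ]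
      ring
    · have : T.filter (· < d + 1) = T.filter (· < d) := by
        refine filter_congr fun x hx => ?_
        have : x ≠ d := fun hxd => h (hxd ▸ hx)
        omega
      rw [this]
      ring

/-- For `d ≤ r`, `α n * q^n` is `(-1)^n q^{(d+1)n² + (d+1)n}`, antisymmetric under `n ↦ -n - 1`. The
case `d = r` is included, which lets the chain return to the kernel relative to `1`. -/
theorem baileyBeta_eq_kernel' (hq : ‖q‖ < 1) (hq0 : q ≠ 0) (hT : ∀ d ∈ T, r ≤ d) {d : ℕ}
    (hd : d ≤ r) (m : ℕ) :
    baileyBeta q r T d m = ∑' n, baileyAlpha q r T d n * baileyKernel' q m n := by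
  refine tsum_baileyKernel_eq_baileyKernel' hq hq0 _ _ fun n => ?_
  rw [baileyAlpha_of_le hq0 hT hd, baileyAlpha_of_le hq0 hT hd, neg_one_zpow_neg_sub_one,
    mul_assoc, mul_assoc, ← zpow_add₀ hq0, ← zpow_add₀ hq0]
  ring_nf

theorem tsum_stepFactor_mul_baileyBeta (hq : ‖q‖ < 1) (hq0 : q ≠ 0) (hT : ∀ d ∈ T, r ≤ d)
    (d m : ℕ) :
    ∑' a : ℕ, stepFactor q r T d m a * invPoch q ((m : ℤ) - a) * baileyBeta q r T d a =
      baileyBeta q r T (d + 1) m := by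
  rcases lt_or_ge d r with hd | hd
  · have hdT : d ∉ T := fun h => by have := hT d h; omega
    simp_rw [baileyBeta_eq_kernel' hq hq0 hT hd.le]
    rw [baileyBeta_eq_kernel' hq hq0 hT hd]
    have h := tsum_kernel_step (α := baileyAlpha q r T d) (baileyKernel'_of_neg q)
      (summable_mul_baileyKernel' q _) (tsum_baileyKernel' hq0 hq m)
    convert h using 1
    · refine tsum_congr fun a => ?_
      rw [stepFactor, if_pos hd, if_neg hdT, mul_one, ← pow_add, ← zpow_natCast]
      push_cast
      rfl
    · refine tsum_congr fun n => ?_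
      rw [baileyAlpha, if_pos hd, if_neg hdT, mul_one, ← zpow_add₀ hq0]
  · by_cases hdT : d ∈ T
    · have h := tsum_kernel_step (α := baileyAlpha q r T d) (baileyKernel_of_neg q)
        (summable_mul_baileyKernel q _) (tsum_binomial_baileyKernel hq0 hq m)
      convert h using 1
      · refine tsum_congr fun a => ?_
        rw [stepFactor, if_neg (not_lt.mpr hd), if_pos hdT, mul_one, ← zpow_natCast,
          ← zpow_natCast, ← zpow_natCast, zpow_neg, baileyBeta]
        push_cast
        rfl
      · refine tsum_congr fun n => ?_
        rw [baileyAlpha, if_neg (not_lt.mpr hd), if_pos hdT, mul_one]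
    · have h := tsum_kernel_step (α := baileyAlpha q r T d) (baileyKernel_of_neg q)
        (summable_mul_baileyKernel q _) (tsum_baileyKernel hq0 hq m)
      convert h using 1
      · refine tsum_congr fun a => ?_
        rw [stepFactor, if_neg (not_lt.mpr hd), if_neg hdT, mul_one, mul_one, ← zpow_natCast,
          baileyBeta]
        push_cast
        rfl
      · refine tsum_congr fun n => ?_
        rw [baileyAlpha, if_neg (not_lt.mpr hd), if_neg hdT, mul_one, mul_one]

theorem norm_topFactor_le (hq : ‖q‖ < 1) (hq0 : q ≠ 0) (d a : ℕ) :
    ‖topFactor q r T d a‖ ≤ ‖q ^ (a ^ 2) * q⁻¹ ^ a‖ := by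
  have h1 : ‖q‖ ^ a ≤ 1 := pow_le_one₀ (norm_nonneg q) hq.le
  have h2 : 1 ≤ (‖q‖ ^ a)⁻¹ := (one_le_inv₀ (pow_pos (norm_pos_iff.mpr hq0) a)).mpr h1
  rw [topFactor, norm_mul, norm_mul, norm_mul, inv_pow]
  have h3 : ‖(if d < r then q ^ a else 1 : ℂ)‖ ≤ 1 := by
    split_ifs
    · rwa [norm_pow]
    · rw [norm_one]
  have h4 : ‖(if d ∈ T then (q ^ a)⁻¹ else 1 : ℂ)‖ ≤ ‖(q ^ a)⁻¹‖ := by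
    split_ifs
    · rfl
    · rwa [norm_one, norm_inv, norm_pow]
  have h5 := mul_le_mul_of_nonneg_left h3 (norm_nonneg (q ^ (a ^ 2)))
  rw [mul_one] at h5
  exact mul_le_mul h5 h4 (norm_nonneg _) (norm_nonneg _)

theorem stepFactor_eq (d m a : ℕ) :
    stepFactor q r T d m a = topFactor q r T d a * (if d ∈ T then 1 + q ^ (m + a) else 1) := by
  rw [stepFactor, topFactor]
  split_ifs <;> ring

theorem norm_stepFactor_le (hq : ‖q‖ < 1) (hq0 : q ≠ 0) (d m a : ℕ) :
    ‖stepFactor q r T d m a‖ ≤ ‖q ^ (a ^ 2) * q⁻¹ ^ a‖ * 2 := by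
  rw [stepFactor_eq, norm_mul]
  refine mul_le_mul (norm_topFactor_le hq hq0 d a) ?_ (norm_nonneg _) (norm_nonneg _)
  split_ifs
  · refine (norm_add_le _ _).trans ?_
    rw [norm_one, norm_pow]
    linarith [pow_le_one₀ (n := m + a) (norm_nonneg q) hq.le]
  · norm_num

/-- The weights of the chain: the factor of an entry, divided by `(q)_{m - a}`. -/
def stepWeight (q : ℂ) (r : ℕ) (T : Finset ℕ) (d m a : ℕ) : ℂ :=
  stepFactor q r T d m a * invPoch q ((m : ℤ) - a)

theorem exists_stepWeight_bounds (hq : ‖q‖ < 1) (hq0 : q ≠ 0) (r : ℕ) (T : Finset ℕ) :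
    ∃ g : ℕ → ℝ, Summable g ∧ (∀ a, 0 ≤ g a) ∧ (∀ d m a, ‖stepWeight q r T d m a‖ ≤ g a) ∧
      (∀ d a, ‖topFactor q r T d a‖ ≤ g a) := by
  obtain ⟨C, hC0, hC⟩ := exists_norm_invPoch_le hq
  -- The `1` serves `topFactor`; in `2 * C`, the `2` bounds `1 + q^{m+a}` and `C` bounds
  -- `1/(q)_{m-a}`.
  refine ⟨fun a => ‖q ^ (a ^ 2) * q⁻¹ ^ a‖ * (1 + 2 * C),
    (summable_pow_sq_mul_pow hq q⁻¹).norm.mul_right _, fun a => by positivity, ?_, ?_⟩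
  · intro d m a
    rw [stepWeight, norm_mul]
    have h := mul_le_mul (norm_stepFactor_le (r := r) (T := T) hq hq0 d m a) (hC (m - a))
      (norm_nonneg _) (by positivity)
    refine h.trans ?_
    rw [mul_assoc]
    exact mul_le_mul_of_nonneg_left (by linarith) (norm_nonneg _)
  · intro d a
    refine (norm_topFactor_le hq hq0 d a).trans ?_
    exact le_mul_of_one_le_right (norm_nonneg _) (by linarith)

theorem baileyBeta_zero (hq : ‖q‖ < 1) (hq0 : q ≠ 0) (m : ℕ) :
    baileyBeta q r T 0 m = (qPoch (q ^ 2) (q ^ 2) m)⁻¹ :=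
  tsum_gauss hq hq0 m

theorem exists_norm_baileyBeta_zero_le (hq : ‖q‖ < 1) (hq0 : q ≠ 0) (r : ℕ) (T : Finset ℕ) :
    ∃ C : ℝ, ∀ m, ‖baileyBeta q r T 0 m‖ ≤ C := by
  have hq2 : ‖q ^ 2‖ < 1 := by
    rw [norm_pow]
    exact pow_lt_one₀ (norm_nonneg q) hq two_ne_zero
  obtain ⟨C, -, hC⟩ := exists_norm_invPoch_le hq2
  refine ⟨C, fun m => ?_⟩
  rw [baileyBeta_zero hq hq0, ← invPoch_natCast]
  exact hC m

/-- The limit of `baileyBeta q r T (k + 1) m` as `m → ∞` is computed twice. The recursion gives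
`1/(q)_∞` times the sum with `topFactor` outermost; the defining sum gives `∑ α n / (q)_∞²`. One
factor `1/(q)_∞` cancels. -/
theorem hasSum_top_chainTerm (hq : ‖q‖ < 1) (hq0 : q ≠ 0) (hT : ∀ d ∈ T, r ≤ d) (k : ℕ)
    (hα : Summable (baileyAlpha q r T (k + 1))) :
    HasSum (fun s : Fin (k + 1) → ℕ => topFactor q r T k (s 0) *
        chainTerm (stepWeight q r T) (baileyBeta q r T 0) k (s 0) (Fin.tail s))
      ((∑' n, baileyAlpha q r T (k + 1) n) / qPochInf q q) := by
  obtain ⟨g, hg, hg0, hw, ht⟩ := exists_stepWeight_bounds hq hq0 r T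
  obtain ⟨C, hC⟩ := exists_norm_baileyBeta_zero_le hq hq0 r T
  have hchain := hasSum_chainTerm hg hg0 hw hC (tsum_stepFactor_mul_baileyBeta hq hq0 hT) k
  have hbd := norm_chainTerm_le hg0 hw hC k
  have h := hasSum_pi_cons hg hg0 (ht k) hbd hchain
  convert h using 1
  have hD : ∀ m, ‖baileyBeta q r T k m‖ ≤ ∑' s : Fin k → ℕ, C * ∏ i, g (s i) := by
    intro m
    rw [← (hchain m).tsum_eq]
    exact tsum_of_norm_bounded ((summable_prod_pi hg hg0 k).mul_left C).hasSum (hbd m)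
  have hlim : Filter.Tendsto (fun m => baileyBeta q r T (k + 1) m) Filter.atTop
      (nhds (∑' a, topFactor q r T k a * (qPochInf q q)⁻¹ * baileyBeta q r T k a)) := by
    simp_rw [← tsum_stepFactor_mul_baileyBeta hq hq0 hT]
    refine tendsto_tsum_of_dominated_convergence
      (bound := fun a => g a * ∑' s : Fin k → ℕ, C * ∏ i, g (s i)) (hg.mul_right _) ?_ ?_
    · intro a
      refine Filter.Tendsto.mul_const _ (Filter.Tendsto.mul ?_ (tendsto_invPoch_sub hq a))
      simp_rw [stepFactor_eq]
      nth_rewrite 2 [← mul_one (topFactor q r T k a)]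
      refine Filter.Tendsto.const_mul _ ?_
      split_ifs
      · have h0 := ((tendsto_pow_atTop_nhds_zero_of_norm_lt_one hq).mul_const (q ^ a)).const_add 1
        simp_rw [← pow_add] at h0
        simpa using h0
      · exact tendsto_const_nhds
    · refine Filter.Eventually.of_forall fun m a => ?_
      rw [norm_mul]
      exact mul_le_mul (hw k m a) (hD a) (norm_nonneg _) (hg0 a)
  have huniq := tendsto_nhds_unique hlim (tendsto_tsum_mul_baileyKernel hq hα)
  have hne := qPochInf_self_ne_zero hq
  simp_rw [mul_right_comm _ (qPochInf q q)⁻¹] at huniq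
  rw [tsum_mul_right, ← mul_assoc] at huniq
  rw [mul_right_cancel₀ (inv_ne_zero hne) huniq, div_eq_mul_inv]

theorem hasSum_baileyAlpha (hq : ‖q‖ < 1) (hq0 : q ≠ 0) (hT : ∀ d ∈ T, r ≤ d) {k : ℕ}
    (hk : r ≤ k) (hTk : ∀ d ∈ T, d < k) :
    HasSum (baileyAlpha q r T k) (bressoudProductSide q k T.card r * qPochInf q q) := by
  set j := T.card with hj
  have hne := qPochInf_self_ne_zero hq
  rw [bressoudProductSide, sum_mul]
  -- Expanding `(q^n + q^{-n})^j` gives triple product series with `p = q^{k+1}` and `x =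
  -- q^{r-j+2s}`.
  have hexp : baileyAlpha q r T k = fun n => ∑ s ∈ range (j + 1), (j.choose s : ℂ) *
      ((-1) ^ n * (q ^ (k + 1)) ^ (n ^ 2) * (q ^ ((r : ℤ) - j + 2 * s)) ^ n) := by
    funext n
    rw [baileyAlpha_of_ge hq0 hT hk, filter_true_of_mem hTk, ← hj, add_pow, mul_sum]
    refine sum_congr rfl fun s hs => ?_
    have hs' : s ≤ j := by simpa [Nat.lt_succ_iff] using hs
    rw [← zpow_natCast q (k + 1), ← zpow_mul, ← zpow_mul, ← zpow_natCast, ← zpow_natCast,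
      ← zpow_mul, ← zpow_mul, mul_assoc, ← mul_assoc (q ^ _), ← zpow_add₀ hq0, ← zpow_add₀ hq0,
      mul_assoc ((-1 : ℂ) ^ n), ← zpow_add₀ hq0]
    have he : ((k : ℤ) + 1) * n ^ 2 + r * n + (n * s + -n * ((j - s : ℕ) : ℤ)) =
        ((k + 1 : ℕ) : ℤ) * n ^ 2 + ((r : ℤ) - j + 2 * s) * n := by
      push_cast [Nat.cast_sub hs']
      ring
    rw [← he, ← add_assoc]
    ring_nf
  rw [hexp]
  refine hasSum_sum fun s _ => ?_
  have hp : ‖q ^ (k + 1)‖ < 1 := by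
    rw [norm_pow]
    exact pow_lt_one₀ (norm_nonneg q) hq k.succ_ne_zero
  have h := (hasSum_jacobi_triple_product (pow_ne_zero (k + 1) hq0) hp
    (zpow_ne_zero ((r : ℤ) - j + 2 * s) hq0)).mul_left (j.choose s : ℂ)
  have e1 : q ^ (k + 1) / q ^ ((r : ℤ) - j + 2 * s) = q ^ ((k : ℤ) + 1 - r + j - 2 * s) := by
    rw [← zpow_natCast, ← zpow_sub₀ hq0]
    congr 1
    push_cast
    ring
  have e2 : q ^ (k + 1) * q ^ ((r : ℤ) - j + 2 * s) = q ^ ((k : ℤ) + 1 + r - j + 2 * s) := by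
    rw [← zpow_natCast, ← zpow_add₀ hq0]
    congr 1
    push_cast
    ring
  rw [e1, e2, ← pow_mul, show (k + 1) * 2 = 2 * k + 2 by ring] at h
  rwa [mul_assoc, div_mul_cancel₀ _ hne]
end

/-! ### Matching the multiple sum with the chain -/

/-- The entry `s_i` of a tuple, numbered from `1`, with no condition on the tuple. -/
def tupleEntry {k : ℕ} (s : Fin k → ℕ) (i : ℕ) : ℕ :=
  if h : 1 ≤ i ∧ i ≤ k then s ⟨i - 1, by omega⟩ else 0

theorem tupleEntry_one {k : ℕ} (s : Fin (k + 1) → ℕ) : tupleEntry s 1 = s 0 := by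
  simp [tupleEntry]

theorem tupleEntry_tail {k : ℕ} (s : Fin (k + 1) → ℕ) {i : ℕ} (hi : 1 ≤ i) :
    tupleEntry (Fin.tail s) i = tupleEntry s (i + 1) := by
  by_cases h : i ≤ k
  · rw [tupleEntry, tupleEntry, dif_pos ⟨hi, h⟩, dif_pos (by omega), Fin.tail]
    congr 1
    ext
    simp
    omega
  · rw [tupleEntry, tupleEntry, dif_neg (by omega), dif_neg (by omega)]

theorem chainTerm_eq_prod (w : ℕ → ℕ → ℕ → ℂ) (β : ℕ → ℂ) (k : ℕ) : ∀ s : Fin (k + 1) → ℕ,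
    chainTerm w β k (s 0) (Fin.tail s) =
      (∏ i ∈ Ico 1 (k + 1), w (k - i) (tupleEntry s i) (tupleEntry s (i + 1))) *
        β (tupleEntry s (k + 1)) := by
  induction k with
  | zero => intro s; simp [chainTerm, tupleEntry_one]
  | succ k ih =>
    intro s
    rw [chainTerm, ih (Fin.tail s), prod_eq_prod_Ico_succ_bot (show 1 < k + 1 + 1 by omega),
      ← prod_Ico_add' _ 1 (k + 1) 1, tupleEntry_tail s (by omega), ← mul_assoc]
    congr 2
    refine prod_congr rfl fun i hi => ?_
    rw [mem_Ico] at hi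
    rw [tupleEntry_tail s hi.1, tupleEntry_tail s (by omega), Nat.add_sub_add_right]

section
variable {q : ℂ} {k j r : ℕ} {S : Finset ℕ}

theorem mem_image_sub_iff (hS : S ⊆ Icc 1 k) {i : ℕ} (hi : i ∈ Icc 1 k) :
    k - i ∈ S.image (k - ·) ↔ i ∈ S := by
  rw [mem_image]
  constructor
  · rintro ⟨x, hx, h⟩
    have := mem_Icc.mp (hS hx)
    rw [mem_Icc] at hi
    rwa [show i = x by omega]
  · exact fun h => ⟨i, h, rfl⟩

theorem prod_binFactor_mul_bressoudTerm (hq0 : q ≠ 0) (hS : S ⊆ Icc 1 (k + 1)) (hr : r ≤ k + 1)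
    (hq : ‖q‖ < 1) (s : DecTuple (k + 1)) :
    (∏ i ∈ S, binFactor q s i) * bressoudTerm q r s =
      topFactor q r (S.image (k + 1 - ·)) k (s.1 0) *
        chainTerm (stepWeight q r (S.image (k + 1 - ·)))
          (baileyBeta q r (S.image (k + 1 - ·)) 0) k (s.1 0) (Fin.tail s.1) := by
  -- The tuple has `k + 1` entries, so `s_i` lies at distance `k + 1 - i` from the last one: the
  -- first is at `k`, the last at `0`.
  set T := S.image (k + 1 - ·) with hT
  set h : ℕ → ℂ := fun i => q ^ (s.entry i ^ 2) * (if k + 1 - i < r then q ^ s.entry i else 1) *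
    (if i ∈ S then binFactor q s i else 1) with hh
  have hmem : ∀ i ∈ Icc 1 (k + 1), (k + 1 - i ∈ T ↔ i ∈ S) := fun i hi =>
    mem_image_sub_iff hS hi
  have htop : topFactor q r T k (s.1 0) = h 1 := by
    have h1 := hmem 1 (by simp)
    rw [Nat.add_sub_cancel] at h1
    have he : s.1 0 = s.entry 1 := (tupleEntry_one s.1).symm
    simp only [hh, topFactor, he, h1, binFactor, if_true, Nat.add_sub_cancel, zpow_neg,
      zpow_natCast]
  have hstep : ∀ i ∈ Ico 1 (k + 1), stepFactor q r T (k - i) (s.entry i) (s.entry (i + 1)) =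
      h (i + 1) := by
    intro i hi
    rw [mem_Ico] at hi
    have h1 := hmem (i + 1) (by simp; omega)
    rw [Nat.add_sub_add_right] at h1
    simp only [hh, stepFactor, h1, binFactor, Nat.add_sub_add_right, zpow_neg,
      zpow_natCast, if_neg (show i + 1 ≠ 1 by omega), Nat.add_sub_cancel]
  have hprod : ∏ i ∈ Icc 1 (k + 1), h i =
      q ^ (∑ i ∈ Icc 1 (k + 1), s.entry i ^ 2 + ∑ i ∈ Icc (k + 1 - r + 1) (k + 1), s.entry i) *
        ∏ i ∈ S, binFactor q s i := by
    simp only [hh]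
    rw [prod_mul_distrib, prod_mul_distrib, prod_pow_eq_pow_sum, ← prod_filter, ← prod_filter,
      filter_mem_eq_inter, inter_eq_right.mpr hS, prod_pow_eq_pow_sum, pow_add]
    congr 4
    ext i
    simp only [mem_filter, mem_Icc]
    omega
  have hchain := chainTerm_eq_prod (stepWeight q r T) (baileyBeta q r T 0) k s.1
  have hsplit : ∏ i ∈ Ico 1 (k + 1), stepWeight q r T (k - i) (tupleEntry s.1 i)
      (tupleEntry s.1 (i + 1)) = (∏ i ∈ Ico 1 (k + 1), h (i + 1)) *
        (∏ i ∈ Ico 1 (k + 1), qPoch q q (s.entry i - s.entry (i + 1)))⁻¹ := by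
    rw [← prod_inv_distrib, ← prod_mul_distrib]
    refine prod_congr rfl fun i hi => ?_
    rw [← hstep i hi, stepWeight]
    congr 1
    have hle : s.entry (i + 1) ≤ s.entry i := by
      rw [mem_Ico] at hi
      rw [DecTuple.entry, DecTuple.entry, dif_pos (by omega), dif_pos (by omega)]
      exact s.2 (by rw [Fin.mk_le_mk]; omega)
    rw [← invPoch_natCast, Nat.cast_sub hle]
    rfl
  have hfull : ∏ i ∈ Icc 1 (k + 1), h i = h 1 * ∏ i ∈ Ico 1 (k + 1), h (i + 1) := by
    rw [prod_Ico_add' h 1 (k + 1) 1, ← prod_eq_prod_Ico_succ_bot (by omega : 1 < k + 1 + 1)]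
    rfl
  rw [hchain, hsplit, htop, baileyBeta_zero hq hq0, bressoudTerm]
  rw [hfull] at hprod
  have he : tupleEntry s.1 (k + 1) = s.entry (k + 1) := rfl
  rw [he, div_eq_mul_inv, mul_inv, ← mul_assoc, mul_comm (∏ i ∈ S, binFactor q s i), ← hprod]
  ring

/-- An ascent `s_i < s_{i+1}` puts a negative index into `invPoch`. The sum over all tuples is
therefore a sum over decreasing ones. -/
theorem top_chainTerm_eq_zero (T : Finset ℕ) (β : ℕ → ℂ) {s : Fin (k + 1) → ℕ}
    (hs : ¬ Antitone s) :
    topFactor q r T k (s 0) * chainTerm (stepWeight q r T) β k (s 0) (Fin.tail s) = 0 := by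
  rw [Fin.antitone_iff_succ_le] at hs
  push Not at hs
  obtain ⟨i, hi⟩ := hs
  have hw : stepWeight q r T (k - (i + 1)) (tupleEntry s (i + 1)) (tupleEntry s (i + 1 + 1)) =
      0 := by
    have h1 : tupleEntry s (i + 1) = s i.castSucc := by
      rw [tupleEntry, dif_pos (by omega)]
      rfl
    have h2 : tupleEntry s (i + 1 + 1) = s i.succ := by
      rw [tupleEntry, dif_pos (by omega)]
      rfl
    rw [stepWeight, h1, h2, invPoch_of_neg q (by omega), mul_zero]
  rw [chainTerm_eq_prod, prod_eq_zero (i := (i : ℕ) + 1) (by simp) hw, zero_mul, mul_zero]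

theorem hasSum_prod_binFactor (hk : 1 ≤ k) (hr : r ≤ k) (hq0 : q ≠ 0) (hq : ‖q‖ < 1)
    (hS : S ⊆ Icc 1 (k - r)) (hSj : S.card = j) :
    HasSum (fun s : DecTuple k => (∏ i ∈ S, binFactor q s i) * bressoudTerm q r s)
      (bressoudProductSide q k j r) := by
  obtain ⟨k, rfl⟩ : ∃ l, k = l + 1 := ⟨k - 1, by omega⟩
  have hSk : S ⊆ Icc 1 (k + 1) := hS.trans (Icc_subset_Icc_right (by omega))
  set T := S.image (k + 1 - ·) with hT
  have hcard : T.card = j := by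
    rw [hT, card_image_of_injOn, hSj]
    intro x hx y hy hxy
    have := mem_Icc.mp (hSk hx)
    have := mem_Icc.mp (hSk hy)
    simp only at hxy
    omega
  have hTr : ∀ d ∈ T, r ≤ d ∧ d < k + 1 := by
    intro d hd
    obtain ⟨x, hx, rfl⟩ := mem_image.mp hd
    have := mem_Icc.mp (hS hx)
    omega
  have hα := hasSum_baileyAlpha hq hq0 (fun d hd => (hTr d hd).1) hr fun d hd => (hTr d hd).2
  have h := hasSum_top_chainTerm hq hq0 (fun d hd => (hTr d hd).1) k hα.summable
  rw [hα.tsum_eq, mul_div_cancel_right₀ _ (qPochInf_self_ne_zero hq), hcard] at h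
  simp_rw [prod_binFactor_mul_bressoudTerm hq0 hSk hr hq]
  refine (hasSum_subtype_iff_of_support_subset (s := {s : Fin (k + 1) → ℕ | Antitone s})
    fun s hs => ?_).mpr h
  by_contra hc
  exact hs (top_chainTerm_eq_zero T _ hc)

theorem prod_binFactor_Icc (hq0 : q ≠ 0) (s : DecTuple k) (j : ℕ) :
    ∏ i ∈ Icc 1 j, binFactor q s i = q ^ (-∑ i ∈ Icc 1 j, (s.entry i : ℤ)) *
      ∏ i ∈ Icc 2 j, (1 + q ^ (s.entry (i - 1) + s.entry i)) := by
  induction j with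
  | zero => simp
  | succ j ih =>
    rw [prod_Icc_succ_top (by omega), ih, sum_Icc_succ_top (by omega), neg_add, zpow_add₀ hq0]
    -- The first factor has no `1 + q^{…}` partner, matching the empty `Icc 2 1`.
    rcases Nat.eq_zero_or_pos j with rfl | hj
    · simp [binFactor]
    · rw [prod_Icc_succ_top (by omega), binFactor, if_neg (by omega)]
      ring
end
end

theorem mainTheorem3 (k j r : ℕ) (hk : 1 ≤ k) (hjr : j + r ≤ k)
    (q : ℂ) (hq0 : q ≠ 0) (hq1 : ‖q‖ < 1) :
    HasSum
      (fun s : DecTuple k =>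
        q ^ (-∑ i ∈ Icc 1 j, (s.entry i : ℤ)) *
          (∏ i ∈ Icc 2 j, (1 + q ^ (s.entry (i - 1) + s.entry i))) * bressoudTerm q r s)
      (bressoudProductSide q k j r) ∧
    ∀ S : Finset ℕ, S ⊆ Icc 1 (k - r) → S.card = j →
      HasSum
        (fun s : DecTuple k => (∏ i ∈ S, binFactor q s i) * bressoudTerm q r s)
        (bressoudProductSide q k j r) := by
  refine ⟨?_, fun S hS hSj => hasSum_prod_binFactor hk (by omega) hq0 hq1 hS hSj⟩
  simp_rw [← prod_binFactor_Icc hq0]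
  exact hasSum_prod_binFactor hk (by omega) hq0 hq1 (Icc_subset_Icc_right (by omega)) (by simp)
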